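/- **Theorem.** Consider an asynchronous shared memory system of $n$ processes that communicate only through $m$ multi-writer multi-reader atomic registers (whose values, like the local states of the processes, come from arbitrary sets). Let $\mathcal T$ be an arbitrary set of timestamps (it may be infinite). A *long-lived timestamp object* supports two methods, each of which an idle process may invoke arbitrarily often: $\mathrm{getTS}()$, which returns an element of $\mathcal T$, and $\mathrm{compare}(t_1,t_2)$ for $t_1,t_2\in\mathcal T$, which returns true or false. It is required that in every execution, whenever a $\mathrm{getTS}$ call that returned $t_1$ responded before the invocation of a $\mathrm{getTS}$ call that returned $t_2$, every later $\mathrm{compare}(t_1,t_2)$ returns true and every later $\mathrm{compare}(t_2,t_1)$ returns false. Processes may be non-deterministic, and the requirement has to hold for all non-deterministic decisions. An implementation satisfies *non-deterministic solo-termination* if from every reachable configuration every process with a pending method call has some finite execution in which only this process takes steps and in which it finishes that call. Every implementation of a long-lived timestamp object for $n$ processes from $m$ such registers that satisfies non-deterministic solo-termination has $$m \;\ge\; \frac n6-1 .$$ Moreover, it has a reachable configuration that is a $(3,\lfloor n/2\rfloor)$-configuration: for some choice, for every process, of the non-deterministic decision on its next step, exactly $\lfloor n/2\rfloor$ processes are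 about to write to a register (they *cover* that register), and every register is covered by at most three processes. -/

import Mathlib

namespace TimestampObject

/-- The two methods of a timestamp object over the timestamp universe `T`, with their arguments. -/
inductive Op (T : Type*) where
  | getTS : Op T
  | compare (t₁ t₂ : T) : Op T

/-- Responses of method calls. -/
inductive Response (T : Type*) where
  | timestamp (t : T) : Response T
  | verdict (b : Bool) : Response T

/-- `getTS` has to return a timestamp, `compare` has to return a Boolean. -/
def Op.Admits {T : Type*} : Op T → Response T → Prop
  | .getTS, .timestamp _ => True
  | .compare _ _, .verdict _ => True
  | _, _ => False

/-- What a process inside a method call can do next: read a register (the next local state depends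
on the value that is read), write a value to a register, make an internal step, or respond.
`V` is the type of register values, `Q` the type of local states. -/
inductive Action (m : ℕ) (T V Q : Type*) where
  | read (r : Fin m) (next : V → Q) : Action m T V Q
  | write (r : Fin m) (v : V) (next : Q) : Action m T V Q
  | internal (next : Q) : Action m T V Q
  | respond (res : Response T) (next : Q) : Action m T V Q

/-- A (non-deterministic) implementation of the methods `getTS` and `compare` for `n` processes
from `m` multi-writer multi-reader registers. Processes keep their local state between calls. -/
structure Implementation (n m : ℕ) (T V Q : Type*) where
  /-- initial register values -/
  initReg : Fin m → V
  /-- initial local states -/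
  initLocal : Fin n → Q
  /-- the local state of a process right after it has invoked a method -/
  invoke : Fin n → Op T → Q → Q
  /-- the possible non-deterministic decisions of a process inside a call -/
  actions : Fin n → Op T → Q → Set (Action m T V Q)

/-- The state of a process: between calls, or inside a call of a method. -/
inductive ProcState (T Q : Type*) where
  | idle (q : Q) : ProcState T Q
  | busy (op : Op T) (q : Q) : ProcState T Q

/-- A configuration: the states of all processes and the values of all registers. -/
structure Config (n m : ℕ) (T V Q : Type*) where
  proc : Fin n → ProcState T Q
  reg : Fin m → V

/-- What is recorded of a single step of a process. -/
inductive Event (m : ℕ) (T V : Type*) where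
  | invoke (op : Op T) : Event m T V
  | read (r : Fin m) (v : V) : Event m T V
  | write (r : Fin m) (v : V) : Event m T V
  | internal : Event m T V
  | respond (res : Response T) : Event m T V

/-- The register to which an event writes, if it is a write. -/
def Event.writeTarget {m : ℕ} {T V : Type*} : Event m T V → Option (Fin m)
  | .write r _ => some r
  | _ => none

/-- The event is the invocation or the response of a method call. -/
def Event.IsInterface {m : ℕ} {T V : Type*} : Event m T V → Prop
  | .invoke _ => True
  | .respond _ => True
  | _ => False

/-- A finite sequence of steps, each with the process that takes it. -/
abbrev Trace (n m : ℕ) (T V : Type*) := List (Fin n × Event m T V)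

namespace Trace

variable {n m : ℕ} {T V : Type*}

/-- In the trace `L`, process `p` invokes `op` in step `i` and this call responds with `res` in
step `j`. -/
def IsCall (L : Trace n m T V) (p : Fin n) (op : Op T) (res : Response T) (i j : ℕ) : Prop :=
  i < j ∧ L[i]? = some (p, .invoke op) ∧ L[j]? = some (p, .respond res) ∧
    ∀ k e, i < k → k < j → L[k]? = some (p, e) → ¬ e.IsInterface

/-- The responses in the trace `L` meet the specification of a timestamp object: they are of the
right kind, and if a `getTS` call that returns `t₁` happens before a `getTS` call that returns
`t₂`, then every later `compare t₁ t₂` returns true and every later `compare t₂ t₁` returns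
false. -/
def MeetsSpec (L : Trace n m T V) : Prop :=
  (∀ p op res i j, L.IsCall p op res i j → op.Admits res) ∧
  ∀ p₁ t₁ i₁ j₁ p₂ t₂ i₂ j₂,
    L.IsCall p₁ .getTS (.timestamp t₁) i₁ j₁ →
    L.IsCall p₂ .getTS (.timestamp t₂) i₂ j₂ →
    j₁ < i₂ →
    ∀ p₃ b i₃ j₃, j₂ < i₃ →
      (L.IsCall p₃ (.compare t₁ t₂) (.verdict b) i₃ j₃ → b = true) ∧
      (L.IsCall p₃ (.compare t₂ t₁) (.verdict b) i₃ j₃ → b = false)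

end Trace

namespace Implementation

variable {n m : ℕ} {T V Q : Type*} (A : Implementation n m T V Q)

/-- The initial configuration: no process is inside a call. -/
def init : Config n m T V Q where
  proc p := .idle (A.initLocal p)
  reg := A.initReg

/-- `A.Step C p e C'`: process `p` can make one step from `C` to `C'`, recorded as `e`. An idle
process may always invoke any method with any arguments (the object is long-lived). -/
inductive Step : Config n m T V Q → Fin n → Event m T V → Config n m T V Q → Prop
  | invoke {C : Config n m T V Q} {p : Fin n} {q : Q} (op : Op T) (h : C.proc p = .idle q) :
      Step C p (.invoke op)
        ⟨Function.update C.proc p (.busy op (A.invoke p op q)), C.reg⟩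
  | read {C : Config n m T V Q} {p : Fin n} {op : Op T} {q : Q} {r : Fin m} {next : V → Q}
      (h : C.proc p = .busy op q) (ha : Action.read r next ∈ A.actions p op q) :
      Step C p (.read r (C.reg r))
        ⟨Function.update C.proc p (.busy op (next (C.reg r))), C.reg⟩
  | write {C : Config n m T V Q} {p : Fin n} {op : Op T} {q : Q} {r : Fin m} {v : V} {next : Q}
      (h : C.proc p = .busy op q) (ha : Action.write r v next ∈ A.actions p op q) :
      Step C p (.write r v)
        ⟨Function.update C.proc p (.busy op next), Function.update C.reg r v⟩
  | internal {C : Config n m T V Q} {p : Fin n} {op : Op T} {q : Q} {next : Q}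
      (h : C.proc p = .busy op q) (ha : Action.internal next ∈ A.actions p op q) :
      Step C p .internal
        ⟨Function.update C.proc p (.busy op next), C.reg⟩
  | respond {C : Config n m T V Q} {p : Fin n} {op : Op T} {q : Q} {res : Response T} {next : Q}
      (h : C.proc p = .busy op q) (ha : Action.respond res next ∈ A.actions p op q) :
      Step C p (.respond res)
        ⟨Function.update C.proc p (.idle next), C.reg⟩

/-- `A.Exec C L C'`: the trace `L` is that of a finite execution from `C` to `C'`. -/
inductive Exec : Config n m T V Q → Trace n m T V → Config n m T V Q → Prop
  | nil (C : Config n m T V Q) : Exec C [] C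
  | cons {C C' C'' : Config n m T V Q} {p : Fin n} {e : Event m T V} {L : Trace n m T V}
      (hs : A.Step C p e C') (hL : Exec C' L C'') : Exec C ((p, e) :: L) C''

/-- Configurations that occur in executions from the initial configuration. -/
def Reachable (C : Config n m T V Q) : Prop := ∃ L, A.Exec A.init L C

/-- Every execution from the initial configuration meets the timestamp specification, whatever the
schedule, the invocations and the non-deterministic decisions are. -/
def IsTimestampObject : Prop := ∀ L C, A.Exec A.init L C → L.MeetsSpec

/-- Non-deterministic solo-termination: from every reachable configuration, every process has some
finite solo execution after which its pending call, if it had one, is finished. -/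
def SoloTerminating : Prop :=
  ∀ C, A.Reachable C → ∀ p : Fin n,
    ∃ L C', A.Exec C L C' ∧ (∀ s ∈ L, s.1 = p) ∧ ∃ q, C'.proc p = .idle q

/-- `d` fixes, for every process, one of the steps that it can take next in `C`. -/
def IsDecision (C : Config n m T V Q) (d : Fin n → Event m T V) : Prop :=
  ∀ p, ∃ C', A.Step C p (d p) C'

/-- The entry of register `r` in the signature: the number of processes that cover `r`, that is,
whose next step under the decisions `d` is a write to `r`. -/
def sig (d : Fin n → Event m T V) (r : Fin m) : ℕ :=
  (Finset.univ.filter fun p => (d p).writeTarget = some r).card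

/-- `(3,k)`-configurations: for some choice of the non-deterministic decisions, exactly `k`
processes cover registers, and no register is covered by more than three of them. -/
def IsThreeConfig (C : Config n m T V Q) (k : ℕ) : Prop :=
  ∃ d : Fin n → Event m T V, A.IsDecision C d ∧ ∑ r, sig d r = k ∧ ∀ r, sig d r ≤ 3

end Implementation

end TimestampObject

namespace TimestampObject

variable {n m : ℕ} {T V Q : Type*}

/-! This is a covering argument. By induction on `k`, any set `P` of at least `2 * k` processes can,
moving alone from any reachable configuration, make `k` of its members cover registers, at most
three per register, with the rest of `P` idle (`signatures_nonempty`). Taking all processes and `k =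
n / 2` gives the required configuration, and counting gives `n / 2 ≤ 3 * m`.

For the induction step, set aside two idle processes `q₀`, `q₁` and let the others reach a signature
with sum `k`. Let `R` be the registers covered three times; their coverers split into disjoint sets
`B₀`, `B₁`, `B₂`, each able to overwrite all of `R`. Suppose that `q₀` after a block write by `B₀`,
and `q₁` after one by `B₁`, both finish `getTS` writing only in `R`. Then the orders `B₀ q₀ B₁ q₁
B₂` and `B₁ q₁ B₀ q₀ B₂` give the same timestamps and end in the same configuration, where one
comparison would have to return both true and false (`escapes_or_escapes`). So one of the two comes
to cover a register `r` outside `R`, and a further block write hides its steps from the others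
(`Escapes.exists_hidden`).

That block write destroys the signature just built. The remedy is to start from a configuration
where the set of signatures still reachable by the other processes can no longer shrink
(`exists_stable`): they reach the same signature again, unaware of the process that covers `r`,
which adds one to an entry below three. -/

theorem Config.ext_of {C D : Config n m T V Q} (hp : ∀ p, C.proc p = D.proc p)
    (hr : ∀ r, C.reg r = D.reg r) : C = D := by
  cases C; cases D
  simp only [Config.mk.injEq]
  exact ⟨funext hp, funext hr⟩

/-! ### Traces and calls that form contiguous blocks. -/

/-- Every step of the trace is taken by a process in `P`. -/
def Trace.OnlyBy (L : Trace n m T V) (P : Set (Fin n)) : Prop := ∀ s ∈ L, s.1 ∈ P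

/-- The trace writes only to registers in `R`. -/
def Trace.WritesWithin (L : Trace n m T V) (R : Set (Fin m)) : Prop :=
  ∀ s ∈ L, ∀ r, s.2.writeTarget = some r → r ∈ R

theorem Trace.OnlyBy.append {L L' : Trace n m T V} {P : Set (Fin n)} (h : L.OnlyBy P)
    (h' : L'.OnlyBy P) : Trace.OnlyBy (L ++ L') P := by
  intro s hs
  rcases List.mem_append.1 hs with hs | hs
  · exact h s hs
  · exact h' s hs

theorem Trace.OnlyBy.mono {L : Trace n m T V} {P P' : Set (Fin n)} (h : L.OnlyBy P)
    (hP : P ⊆ P') : L.OnlyBy P' := fun s hs => hP (h s hs)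

/-- The steps `M` of `p`, preceded by the invocation of `op` and followed by the response `res`. -/
def Trace.call (p : Fin n) (op : Op T) (M : Trace n m T V) (res : Response T) : Trace n m T V :=
  (p, .invoke op) :: M ++ [(p, .respond res)]

theorem Trace.OnlyBy.call {M : Trace n m T V} {p : Fin n} (h : M.OnlyBy {p}) (op : Op T)
    (res : Response T) : Trace.OnlyBy (Trace.call p op M res) {p} := by
  intro s hs
  simp only [Trace.call, List.cons_append, List.mem_cons, List.mem_append, List.not_mem_nil,
    or_false] at hs
  rcases hs with rfl | hs | rfl
  · rfl
  · exact h s hs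
  · rfl

/-- A call occurring as a contiguous block of steps, with no interface event in between. -/
theorem Trace.isCall_of_block (L₁ L₂ M : Trace n m T V) {p : Fin n} {op : Op T} {res : Response T}
    (hM : ∀ s ∈ M, ¬ s.2.IsInterface) :
    Trace.IsCall (L₁ ++ Trace.call p op M res ++ L₂) p op res
      L₁.length (L₁.length + M.length + 1) := by
  unfold Trace.call
  refine ⟨by omega, ?_, ?_, ?_⟩
  · simp
  · rw [List.append_assoc, List.getElem?_append_right (by omega)]
    have : L₁.length + M.length + 1 - L₁.length = M.length + 1 := by omega
    rw [this]
    simp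
  · intro k e h₁ h₂ hk
    obtain ⟨j, rfl⟩ : ∃ j, k = L₁.length + (j + 1) := ⟨k - L₁.length - 1, by omega⟩
    have hj : j < M.length := by omega
    rw [List.append_assoc, List.getElem?_append_right (by omega)] at hk
    simp only [Nat.add_sub_cancel_left, List.cons_append, List.getElem?_cons_succ,
      List.append_assoc] at hk
    rw [List.getElem?_append_left hj] at hk
    exact hM _ (List.mem_of_getElem? hk)

namespace Implementation

variable {A : Implementation n m T V Q}

/-! ### Locality and replay of executions. -/

theorem Step.proc_eq {C C' : Config n m T V Q} {p q : Fin n} {e : Event m T V}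
    (h : A.Step C p e C') (hq : q ≠ p) : C'.proc q = C.proc q := by
  cases h <;> simp [Function.update_of_ne hq]

theorem Step.reg_eq {C C' : Config n m T V Q} {p : Fin n} {e : Event m T V} {r : Fin m}
    (h : A.Step C p e C') (hr : e.writeTarget ≠ some r) : C'.reg r = C.reg r := by
  cases h <;> try rfl
  rename_i r' _ _ _ _
  have : r ≠ r' := by rintro rfl; exact hr rfl
  simp [Function.update_of_ne this]

/-- A step of `p` depends only on the state of `p` and on the registers. -/
theorem Step.replay {C C' D : Config n m T V Q} {p : Fin n} {e : Event m T V}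
    (h : A.Step C p e C') (hp : D.proc p = C.proc p) (hr : D.reg = C.reg) :
    A.Step D p e ⟨Function.update D.proc p (C'.proc p), C'.reg⟩ := by
  cases h with
  | invoke op h => simpa [hr] using Step.invoke (A := A) op (hp.trans h)
  | read h ha => simpa [hr] using Step.read (A := A) (hp.trans h) ha
  | write h ha => simpa [hr] using Step.write (A := A) (hp.trans h) ha
  | internal h ha => simpa [hr] using Step.internal (A := A) (hp.trans h) ha
  | respond h ha => simpa [hr] using Step.respond (A := A) (hp.trans h) ha

theorem Exec.append {C C' C'' : Config n m T V Q} {L L' : Trace n m T V} (h : A.Exec C L C')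
    (h' : A.Exec C' L' C'') : A.Exec C (L ++ L') C'' := by
  induction h with
  | nil => exact h'
  | cons hs _ ih => exact .cons hs (ih h')

theorem Exec.single {C C' : Config n m T V Q} {p : Fin n} {e : Event m T V}
    (h : A.Step C p e C') : A.Exec C [(p, e)] C' := .cons h (.nil _)

theorem Reachable.exec {C C' : Config n m T V Q} {L : Trace n m T V} (hC : A.Reachable C)
    (h : A.Exec C L C') : A.Reachable C' := by
  obtain ⟨M, hM⟩ := hC
  exact ⟨M ++ L, hM.append h⟩

theorem Exec.proc_eq {C C' : Config n m T V Q} {L : Trace n m T V} (h : A.Exec C L C')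
    {P : Set (Fin n)} (hL : L.OnlyBy P) {q : Fin n} (hq : q ∉ P) : C'.proc q = C.proc q := by
  induction h with
  | nil => rfl
  | cons hs _ ih =>
    rw [ih fun s hs => hL s (List.mem_cons_of_mem _ hs), hs.proc_eq]
    rintro rfl
    exact hq (hL _ List.mem_cons_self)

theorem Exec.reg_eq {C C' : Config n m T V Q} {L : Trace n m T V} (h : A.Exec C L C')
    {R : Set (Fin m)} (hL : L.WritesWithin R) {r : Fin m} (hr : r ∉ R) :
    C'.reg r = C.reg r := by
  induction h with
  | nil => rfl
  | cons hs _ ih =>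
    rw [ih fun s hs => hL s (List.mem_cons_of_mem _ hs), hs.reg_eq]
    exact fun he => hr (hL _ List.mem_cons_self r he)

/-- An execution by processes in `P` can be replayed from every configuration that these processes
cannot distinguish from its first one. -/
theorem Exec.replay {C C' : Config n m T V Q} {L : Trace n m T V} (h : A.Exec C L C')
    {P : Set (Fin n)} (hL : L.OnlyBy P) {D : Config n m T V Q}
    (hp : ∀ p ∈ P, D.proc p = C.proc p) (hr : D.reg = C.reg) :
    ∃ D', A.Exec D L D' ∧ (∀ p ∈ P, D'.proc p = C'.proc p) ∧ D'.reg = C'.reg := by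
  induction h generalizing D with
  | nil C => exact ⟨D, .nil _, hp, hr⟩
  | @cons C C₁ C₂ p e L hs _ ih =>
    have hpP : p ∈ P := hL _ List.mem_cons_self
    have hstep := hs.replay (hp p hpP) hr
    obtain ⟨D', hD', h1, h2⟩ := ih (fun s hs => hL s (List.mem_cons_of_mem _ hs))
      (D := ⟨Function.update D.proc p (C₁.proc p), C₁.reg⟩) (by
        intro q hq
        rcases eq_or_ne q p with rfl | hqp
        · simp
        · simp [Function.update_of_ne hqp, hs.proc_eq hqp, hp q hq]) rfl
    exact ⟨D', .cons hstep hD', h1, h2⟩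

/-! ### Completing calls in solo executions. -/

/-- A solo execution that takes a busy process to an idle state starts with the completion of the
pending call. -/
theorem Exec.exists_respond {C C' : Config n m T V Q} {L : Trace n m T V} (h : A.Exec C L C')
    {p : Fin n} (hL : L.OnlyBy {p}) {op : Op T} {q q' : Q} (hq : C.proc p = .busy op q)
    (hq' : C'.proc p = .idle q') :
    ∃ M res C₁, A.Exec C (M ++ [(p, .respond res)]) C₁ ∧ Trace.OnlyBy M {p} ∧
      (∀ s ∈ M, ¬ s.2.IsInterface) ∧ ∃ q₁, C₁.proc p = .idle q₁ := by
  induction h generalizing q with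
  | nil => simp [hq] at hq'
  | @cons C C₁ C₂ p' e L hs _ ih =>
    obtain rfl : p' = p := hL _ List.mem_cons_self
    have hL' : Trace.OnlyBy L {p'} := fun s hs => hL s (List.mem_cons_of_mem _ hs)
    -- A step that is no interface event leaves the same call pending, so it can be prepended to
    -- what the induction hypothesis yields.
    have key : ∀ q₁, C₁.proc p' = .busy op q₁ → ¬ e.IsInterface → ∃ M res C₁,
        A.Exec C (M ++ [(p', .respond res)]) C₁ ∧ Trace.OnlyBy M {p'} ∧
        (∀ s ∈ M, ¬ s.2.IsInterface) ∧ ∃ q₁, C₁.proc p' = .idle q₁ := by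
      intro q₁ h₁ he
      obtain ⟨M, res, C₃, hM, hM', hM'', h₃⟩ := ih hL' h₁ hq'
      refine ⟨(p', e) :: M, res, C₃, .cons hs hM, ?_, ?_, h₃⟩
      · intro s hs
        rcases List.mem_cons.1 hs with rfl | hs
        · rfl
        · exact hM' s hs
      · intro s hs
        rcases List.mem_cons.1 hs with rfl | hs
        · exact he
        · exact hM'' s hs
    have hs' := hs
    cases hs with
    | invoke op h => simp [hq] at h
    | read h ha =>
      obtain ⟨rfl, rfl⟩ := by simpa [hq] using h
      exact key _ (by simp; rfl) (by simp [Event.IsInterface])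
    | write h ha =>
      obtain ⟨rfl, rfl⟩ := by simpa [hq] using h
      exact key _ (by simp; rfl) (by simp [Event.IsInterface])
    | internal h ha =>
      obtain ⟨rfl, rfl⟩ := by simpa [hq] using h
      exact key _ (by simp; rfl) (by simp [Event.IsInterface])
    | respond h ha =>
      exact ⟨[], _, _, Exec.single hs', by simp [Trace.OnlyBy], by simp, _, by simp; rfl⟩

/-- An idle process can complete any call in a solo execution. -/
theorem SoloTerminating.exists_call (hsolo : A.SoloTerminating) {C : Config n m T V Q}
    (hC : A.Reachable C) {p : Fin n} {q : Q} (hq : C.proc p = .idle q) (op : Op T) :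
    ∃ M res C', A.Exec C (Trace.call p op M res) C' ∧
      Trace.OnlyBy M {p} ∧ (∀ s ∈ M, ¬ s.2.IsInterface) := by
  have hs : A.Step C p (.invoke op) _ := Step.invoke op hq
  obtain ⟨L, C', hL, hLp, q', hq'⟩ := hsolo _ (hC.exec (Exec.single hs)) p
  obtain ⟨M, res, C₁, h₁, h₂, h₃, -⟩ := hL.exists_respond (p := p) (fun s hs => hLp s hs)
    (op := op) (q := A.invoke p op q) (by simp) hq'
  exact ⟨M, res, C₁, .cons hs h₁, h₂, h₃⟩

/-- Finitely many processes can be made idle. -/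
theorem SoloTerminating.exists_idle (hsolo : A.SoloTerminating) {C : Config n m T V Q}
    (hC : A.Reachable C) (P : Finset (Fin n)) :
    ∃ L C', A.Exec C L C' ∧ L.OnlyBy P ∧ ∀ p ∈ P, ∃ q, C'.proc p = .idle q := by
  induction P using Finset.induction_on with
  | empty => exact ⟨[], C, .nil _, by simp [Trace.OnlyBy], by simp⟩
  | @insert a P ha ih =>
    obtain ⟨L, C', hL, hLP, hi⟩ := ih
    obtain ⟨L', C'', hL', hLa, hq⟩ := hsolo C' (hC.exec hL) a
    have hL'a : L'.OnlyBy {a} := fun s hs => hLa s hs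
    refine ⟨L ++ L', C'', hL.append hL', (hLP.mono (by simp)).append (hL'a.mono (by simp)), ?_⟩
    intro p hp
    rcases Finset.mem_insert.1 hp with rfl | hp
    · exact hq
    · rw [hL'.proc_eq hL'a (by rintro h; exact ha (Set.mem_singleton_iff.1 h ▸ hp))]
      exact hi p hp

/-! ### Covering and block writes. -/

/-- In `C`, process `p` can write to register `r` in its next step. -/
def Covers (A : Implementation n m T V Q) (C : Config n m T V Q) (p : Fin n) (r : Fin m) : Prop :=
  ∃ op q v next, C.proc p = .busy op q ∧ Action.write r v next ∈ A.actions p op q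

/-- Either all writes of an execution are in `R`, or some prefix of it with this property leads to
a configuration in which a register outside `R` is covered. -/
theorem Exec.writesWithin_or_exists_covers {C C' : Config n m T V Q} {L : Trace n m T V}
    (h : A.Exec C L C') {p : Fin n} (hL : L.OnlyBy {p}) (R : Set (Fin m)) :
    L.WritesWithin R ∨ ∃ M E r, A.Exec C M E ∧ M.OnlyBy {p} ∧ M.WritesWithin R ∧ r ∉ R ∧
      A.Covers E p r := by
  induction h with
  | nil => left; simp [Trace.WritesWithin]
  | @cons C C₁ C₂ p' e L hs _ ih =>
    obtain rfl : p' = p := hL _ List.mem_cons_self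
    by_cases he : ∀ r, e.writeTarget = some r → r ∈ R
    · rcases ih fun s hs => hL s (List.mem_cons_of_mem _ hs) with h | ⟨M, E, r, h₁, h₂, h₃, h₄, h₅⟩
      · left
        intro s hs
        rcases List.mem_cons.1 hs with rfl | hs
        · exact he
        · exact h s hs
      · right
        refine ⟨(p', e) :: M, E, r, .cons hs h₁, ?_, ?_, h₄, h₅⟩
        · intro s hs
          rcases List.mem_cons.1 hs with rfl | hs
          · rfl
          · exact h₂ s hs
        · intro s hs
          rcases List.mem_cons.1 hs with rfl | hs
          · exact he
          · exact h₃ s hs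
    · right
      push Not at he
      obtain ⟨r, her, hr⟩ := he
      refine ⟨[], C, r, .nil _, by simp [Trace.OnlyBy], by simp [Trace.WritesWithin], hr, ?_⟩
      cases hs with
      | write h ha =>
        simp only [Event.writeTarget, Option.some.injEq] at her
        subst her
        exact ⟨_, _, _, _, h, ha⟩
      | _ => simp [Event.writeTarget] at her

/-- From `C`, the processes in `B` can write the values `w` to the registers `R` and move to the
states `π`, wherever the other processes are and whatever the registers contain. -/
def BlockWrite (A : Implementation n m T V Q) (C : Config n m T V Q) (B : Set (Fin n))
    (R : Set (Fin m)) (w : Fin m → V) (π : Fin n → ProcState T Q) : Prop :=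
  ∀ D : Config n m T V Q, (∀ p ∈ B, D.proc p = C.proc p) →
    ∃ L D', A.Exec D L D' ∧ L.OnlyBy B ∧ (∀ p ∈ B, D'.proc p = π p) ∧
      (∀ r ∈ R, D'.reg r = w r) ∧ ∀ r ∉ R, D'.reg r = D.reg r

/-- Distinct registers have distinct writers, so each writer is still poised when its turn comes.
The values written and the resulting states come from the poised actions in `C`, hence do not depend
on the starting configuration. -/
theorem exists_blockWrite (A : Implementation n m T V Q) (C : Config n m T V Q)
    (R : Finset (Fin m)) (b : Fin m → Fin n) (hb : ∀ r ∈ R, ∀ r' ∈ R, b r = b r' → r = r')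
    (hc : ∀ r ∈ R, A.Covers C (b r) r) :
    ∃ w π, A.BlockWrite C (b '' R) R w π := by
  induction R using Finset.induction_on with
  | empty =>
    exact ⟨C.reg, C.proc, fun D _ => ⟨[], D, .nil _, by simp [Trace.OnlyBy], by simp, by simp,
      by simp⟩⟩
  | @insert a R ha ih =>
    obtain ⟨w, π, hw⟩ := ih (fun r hr r' hr' => hb r (by simp [hr]) r' (by simp [hr']))
      fun r hr => hc r (by simp [hr])
    obtain ⟨op, q, v, next, hq, hact⟩ := hc a (by simp)
    have hnot : b a ∉ b '' R := by
      rintro ⟨r, hr, hra⟩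
      have := hb r (by simp [Finset.mem_coe.1 hr]) a (by simp) hra
      subst this
      exact ha hr
    refine ⟨Function.update w a v, Function.update π (b a) (.busy op next), fun D hD => ?_⟩
    obtain ⟨L, D', hL, hLB, h₁, h₂, h₃⟩ := hw D fun p hp =>
      hD p (Set.image_mono (by simp) hp)
    have hD'a : D'.proc (b a) = .busy op q := by
      rw [hL.proc_eq hLB hnot, hD _ ⟨a, by simp, rfl⟩, hq]
    have hstep := Step.write (A := A) hD'a hact
    refine ⟨L ++ [(b a, .write a v)], _, hL.append (Exec.single hstep), ?_, ?_, ?_, ?_⟩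
    · refine (hLB.mono (Set.image_mono (by simp))).append ?_
      intro s hs
      rw [List.mem_singleton.1 hs]
      exact ⟨a, by simp, rfl⟩
    · rintro p ⟨r, hr, rfl⟩
      rcases Finset.mem_insert.1 (Finset.mem_coe.1 hr) with rfl | hr
      · simp
      · have : b r ≠ b a := fun h => hnot ⟨r, hr, h⟩
        simp [Function.update_of_ne this, h₁ _ ⟨r, hr, rfl⟩]
    · intro r hr
      rcases eq_or_ne r a with rfl | hra
      · simp
      · have hrR : r ∈ R := by simpa [hra] using hr
        simp [Function.update_of_ne hra, h₂ r hrR]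
    · intro r hr
      simp only [Finset.coe_insert, Set.mem_insert_iff, Finset.mem_coe, not_or] at hr
      simp [Function.update_of_ne hr.1, h₃ r hr.2]

/-! ### Two orders of `getTS` calls with the same final configuration. -/

theorem IsTimestampObject.admits (hA : A.IsTimestampObject) {K K' M : Trace n m T V} {p : Fin n}
    {op : Op T} {res : Response T} {C : Config n m T V Q}
    (h : A.Exec A.init (K ++ Trace.call p op M res ++ K') C)
    (hM : ∀ s ∈ M, ¬ s.2.IsInterface) : op.Admits res :=
  (hA _ _ h).1 _ _ _ _ _ (Trace.isCall_of_block K K' M hM)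

/-- The verdict of a comparison of two timestamps that were obtained one after the other. -/
theorem IsTimestampObject.verdict (hA : A.IsTimestampObject)
    {K₀ K₁ K₂ M₀ M₁ M₂ : Trace n m T V} {p₀ p₁ p₂ : Fin n} {t₀ t₁ x y : T} {b : Bool}
    {C : Config n m T V Q}
    (h : A.Exec A.init (K₀ ++ Trace.call p₀ .getTS M₀ (.timestamp t₀) ++ K₁ ++
      Trace.call p₁ .getTS M₁ (.timestamp t₁) ++ K₂ ++
      Trace.call p₂ (.compare x y) M₂ (.verdict b)) C)
    (hM₀ : ∀ s ∈ M₀, ¬ s.2.IsInterface) (hM₁ : ∀ s ∈ M₁, ¬ s.2.IsInterface)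
    (hM₂ : ∀ s ∈ M₂, ¬ s.2.IsInterface) :
    (x = t₀ ∧ y = t₁ → b = true) ∧ (x = t₁ ∧ y = t₀ → b = false) := by
  set c₀ := Trace.call p₀ .getTS M₀ (.timestamp t₀) with hc₀
  set c₁ := Trace.call p₁ .getTS M₁ (.timestamp t₁) with hc₁
  set c₂ := Trace.call p₂ (.compare x y) M₂ (.verdict b) with hc₂
  have l₀ : c₀.length = M₀.length + 2 := by simp [hc₀, Trace.call]
  have l₁ : c₁.length = M₁.length + 2 := by simp [hc₁, Trace.call]
  have i₀ := Trace.isCall_of_block K₀ (K₁ ++ c₁ ++ K₂ ++ c₂) M₀ (p := p₀) (op := .getTS)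
    (res := .timestamp t₀) hM₀
  have i₁ := Trace.isCall_of_block (K₀ ++ c₀ ++ K₁) (K₂ ++ c₂) M₁ (p := p₁) (op := .getTS)
    (res := .timestamp t₁) hM₁
  have i₂ := Trace.isCall_of_block (K₀ ++ c₀ ++ K₁ ++ c₁ ++ K₂) [] M₂ (p := p₂)
    (op := .compare x y) (res := .verdict b) hM₂
  rw [← hc₀] at i₀
  rw [← hc₁] at i₁
  rw [← hc₂] at i₂
  simp only [List.append_assoc, List.append_nil] at h i₀ i₁ i₂
  have key := fun j => (hA _ _ h).2 _ _ _ _ _ _ _ _ i₀ i₁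
    (by simp only [List.length_append]; omega) p₂ b
    (K₀ ++ (c₀ ++ (K₁ ++ (c₁ ++ K₂)))).length j (by simp only [List.length_append]; omega)
  constructor
  · rintro ⟨rfl, rfl⟩
    exact (key _).1 i₂
  · rintro ⟨rfl, rfl⟩
    exact (key _).2 i₂

/-- After a block write and a solo execution of `q₀` that writes only within `R`, a block write by
further processes makes `q₁` repeat its solo execution; one more block write then determines the
contents of all registers. -/
theorem exists_exec_of_blockWrites {C D₀ D₁ E₀ E₁ : Config n m T V Q} {B₀ B₁ B₂ : Set (Fin n)}
    {R : Set (Fin m)} {w₁ w₂ : Fin m → V} {π₁ π₂ : Fin n → ProcState T Q} {q₀ q₁ : Fin n}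
    {L₀ α₀ α₁ : Trace n m T V}
    (h₀₁ : Disjoint B₀ B₁) (h₀₂ : Disjoint B₀ B₂) (h₁₂ : Disjoint B₁ B₂)
    (hq₀ : q₀ ∉ B₀ ∪ B₁ ∪ B₂) (hq₁ : q₁ ∉ B₀ ∪ B₁ ∪ B₂) (hq : q₀ ≠ q₁)
    (hB₁ : A.BlockWrite C B₁ R w₁ π₁) (hB₂ : A.BlockWrite C B₂ R w₂ π₂)
    (hL₀ : A.Exec C L₀ D₀) (hL₀B : L₀.OnlyBy B₀) (hD₀ : ∀ r ∉ R, D₀.reg r = C.reg r)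
    (hα₀ : A.Exec D₀ α₀ E₀) (hα₀q : α₀.OnlyBy {q₀}) (hα₀R : α₀.WritesWithin R)
    (hD₁q : D₁.proc q₁ = C.proc q₁) (hD₁R : ∀ r ∈ R, D₁.reg r = w₁ r)
    (hD₁ : ∀ r ∉ R, D₁.reg r = C.reg r)
    (hα₁ : A.Exec D₁ α₁ E₁) (hα₁q : α₁.OnlyBy {q₁}) (hα₁R : α₁.WritesWithin R) :
    ∃ X Y G, A.Exec C (L₀ ++ α₀ ++ X ++ α₁ ++ Y) G ∧ (∀ p ∈ B₀, G.proc p = D₀.proc p) ∧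
      (∀ p ∈ B₁, G.proc p = π₁ p) ∧ (∀ p ∈ B₂, G.proc p = π₂ p) ∧
      G.proc q₀ = E₀.proc q₀ ∧ G.proc q₁ = E₁.proc q₁ ∧
      (∀ p, p ∉ B₀ ∪ B₁ ∪ B₂ → p ≠ q₀ → p ≠ q₁ → G.proc p = C.proc p) ∧
      (∀ r ∈ R, G.reg r = w₂ r) ∧ ∀ r ∉ R, G.reg r = C.reg r := by
  simp only [Set.mem_union, not_or] at hq₀ hq₁
  obtain ⟨⟨hq₀₀, hq₀₁⟩, hq₀₂⟩ := hq₀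
  obtain ⟨⟨hq₁₀, hq₁₁⟩, hq₁₂⟩ := hq₁
  have E₀p : ∀ p, p ∉ B₀ → p ≠ q₀ → E₀.proc p = C.proc p := fun p h h' => by
    rw [hα₀.proc_eq hα₀q h', hL₀.proc_eq hL₀B h]
  obtain ⟨X, F, hX, hXB, hF₁, hF₂, hF₃⟩ := hB₁ E₀ fun p hp =>
    E₀p p (fun h => Set.disjoint_left.1 h₀₁ h hp) (by rintro rfl; exact hq₀₁ hp)
  have Fp : ∀ p, p ∉ B₀ → p ∉ B₁ → p ≠ q₀ → F.proc p = C.proc p := fun p h h₁ h' => by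
    rw [hX.proc_eq hXB h₁, E₀p p h h']
  -- The block write by `B₁` erases all traces of `α₀`: inside `R` everything is overwritten,
  -- outside `R` nothing was written.
  have Freg : F.reg = D₁.reg := by
    funext r
    by_cases hr : r ∈ R
    · rw [hF₂ r hr, hD₁R r hr]
    · rw [hF₃ r hr, hα₀.reg_eq hα₀R hr, hD₀ r hr, hD₁ r hr]
  obtain ⟨F', hα₁', hF'q, hF'r⟩ := hα₁.replay hα₁q (D := F) (by
    rintro p rfl
    rw [Fp p hq₁₀ hq₁₁ hq.symm, hD₁q]) Freg
  have F'p : ∀ p, p ≠ q₁ → F'.proc p = F.proc p := fun p h => hα₁'.proc_eq hα₁q h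
  obtain ⟨Y, G, hY, hYB, hG₁, hG₂, hG₃⟩ := hB₂ F' fun p hp => by
    rw [F'p p (by rintro rfl; exact hq₁₂ hp),
      Fp p (fun h => Set.disjoint_left.1 h₀₂ h hp) (fun h => Set.disjoint_left.1 h₁₂ h hp)
        (by rintro rfl; exact hq₀₂ hp)]
  have Gp : ∀ p, p ∉ B₂ → G.proc p = F'.proc p := fun p h => hY.proc_eq hYB h
  refine ⟨X, Y, G, (((hL₀.append hα₀).append hX).append hα₁').append hY, ?_, ?_, hG₁, ?_, ?_, ?_,
    hG₂, ?_⟩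
  · intro p hp
    rw [Gp p (fun h => Set.disjoint_left.1 h₀₂ hp h), F'p p (by rintro rfl; exact hq₁₀ hp),
      hX.proc_eq hXB (fun h => Set.disjoint_left.1 h₀₁ hp h),
      hα₀.proc_eq hα₀q (by rintro rfl; exact hq₀₀ hp)]
  · intro p hp
    rw [Gp p (fun h => Set.disjoint_left.1 h₁₂ hp h), F'p p (by rintro rfl; exact hq₁₁ hp),
      hF₁ p hp]
  · rw [Gp _ hq₀₂, F'p _ hq, hX.proc_eq hXB hq₀₁]
  · rw [Gp _ hq₁₂, hF'q _ rfl]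
  · intro p hp hp₀ hp₁
    simp only [Set.mem_union, not_or] at hp
    rw [Gp p hp.2, F'p p hp₁, Fp p hp.1.1 hp.1.2 hp₀]
  · intro r hr
    rw [hG₃ r hr, hF'r, hα₁.reg_eq hα₁R hr, hD₁ r hr]

/-- A solo execution of `p` from `D` writes only within `R` and makes `p` cover a register outside
of `R`. -/
def Escapes (A : Implementation n m T V Q) (D : Config n m T V Q) (p : Fin n) (R : Set (Fin m)) :
    Prop :=
  ∃ M E r, A.Exec D M E ∧ M.OnlyBy {p} ∧ M.WritesWithin R ∧ r ∉ R ∧ A.Covers E p r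

/-- If `R` is covered by three disjoint sets of processes, then after a block write by one of the
first two sets one of two idle processes has to write outside of `R` in order to get a timestamp. -/
theorem escapes_or_escapes (hA : A.IsTimestampObject) (hsolo : A.SoloTerminating)
    {C D₀ D₁ : Config n m T V Q} (hC : A.Reachable C) {B₀ B₁ B₂ : Set (Fin n)}
    {R : Set (Fin m)} {w₀ w₁ w₂ : Fin m → V} {π₀ π₁ π₂ : Fin n → ProcState T Q} {q₀ q₁ : Fin n}
    {L₀ L₁ : Trace n m T V}
    (h₀₁ : Disjoint B₀ B₁) (h₀₂ : Disjoint B₀ B₂) (h₁₂ : Disjoint B₁ B₂)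
    (hq₀ : q₀ ∉ B₀ ∪ B₁ ∪ B₂) (hq₁ : q₁ ∉ B₀ ∪ B₁ ∪ B₂) (hq : q₀ ≠ q₁)
    (hi₀ : ∃ s, C.proc q₀ = .idle s) (hi₁ : ∃ s, C.proc q₁ = .idle s)
    (hB₀ : A.BlockWrite C B₀ R w₀ π₀) (hB₁ : A.BlockWrite C B₁ R w₁ π₁)
    (hB₂ : A.BlockWrite C B₂ R w₂ π₂)
    (hL₀ : A.Exec C L₀ D₀) (hL₀B : L₀.OnlyBy B₀) (hD₀B : ∀ p ∈ B₀, D₀.proc p = π₀ p)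
    (hD₀R : ∀ r ∈ R, D₀.reg r = w₀ r) (hD₀ : ∀ r ∉ R, D₀.reg r = C.reg r)
    (hL₁ : A.Exec C L₁ D₁) (hL₁B : L₁.OnlyBy B₁) (hD₁B : ∀ p ∈ B₁, D₁.proc p = π₁ p)
    (hD₁R : ∀ r ∈ R, D₁.reg r = w₁ r) (hD₁ : ∀ r ∉ R, D₁.reg r = C.reg r) :
    A.Escapes D₀ q₀ R ∨ A.Escapes D₁ q₁ R := by
  have hq₀B : q₀ ∉ B₀ := fun h => hq₀ (by simp [h])
  have hq₁B : q₁ ∉ B₁ := fun h => hq₁ (by simp [h])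
  have hD₀q : D₀.proc q₀ = C.proc q₀ := hL₀.proc_eq hL₀B hq₀B
  have hD₁q : D₁.proc q₁ = C.proc q₁ := hL₁.proc_eq hL₁B hq₁B
  obtain ⟨s₀, hs₀⟩ := hi₀
  obtain ⟨s₁, hs₁⟩ := hi₁
  obtain ⟨M₀, res₀, E₀, hα₀, hM₀q, hM₀⟩ :=
    hsolo.exists_call (hC.exec hL₀) (hD₀q.trans hs₀) .getTS
  obtain ⟨M₁, res₁, E₁, hα₁, hM₁q, hM₁⟩ :=
    hsolo.exists_call (hC.exec hL₁) (hD₁q.trans hs₁) .getTS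
  rcases hα₀.writesWithin_or_exists_covers (hM₀q.call _ _) R with hR₀ | h
  swap
  · exact .inl h
  rcases hα₁.writesWithin_or_exists_covers (hM₁q.call _ _) R with hR₁ | h
  swap
  · exact .inr h
  exfalso
  obtain ⟨X, Y, G, hG, g₀, g₁, g₂, gq₀, gq₁, gp, gR, gr⟩ :=
    exists_exec_of_blockWrites h₀₁ h₀₂ h₁₂ hq₀ hq₁ hq hB₁ hB₂ hL₀ hL₀B hD₀ hα₀ (hM₀q.call _ _)
      hR₀ hD₁q hD₁R hD₁ hα₁ (hM₁q.call _ _) hR₁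
  have hc : B₁ ∪ B₀ ∪ B₂ = B₀ ∪ B₁ ∪ B₂ := by rw [Set.union_comm B₁]
  -- The same construction with the indices 0 and 1 exchanged.
  obtain ⟨X', Y', G', hG', g₁', g₀', g₂', gq₁', gq₀', gp', gR', gr'⟩ :=
    exists_exec_of_blockWrites h₀₁.symm h₁₂ h₀₂ (hc ▸ hq₁) (hc ▸ hq₀) hq.symm hB₀ hB₂ hL₁ hL₁B
      hD₁ hα₁ (hM₁q.call _ _) hR₁ hD₀q hD₀R hD₀ hα₀ (hM₀q.call _ _) hR₀
  have hGG : G' = G := by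
    refine Config.ext_of (fun p => ?_) fun r => ?_
    · by_cases p₀ : p ∈ B₀
      · rw [g₀ p p₀, g₀' p p₀, hD₀B p p₀]
      by_cases p₁ : p ∈ B₁
      · rw [g₁ p p₁, g₁' p p₁, hD₁B p p₁]
      by_cases p₂ : p ∈ B₂
      · rw [g₂ p p₂, g₂' p p₂]
      rcases eq_or_ne p q₀ with rfl | hp₀
      · rw [gq₀, gq₀']
      rcases eq_or_ne p q₁ with rfl | hp₁
      · rw [gq₁, gq₁']
      rw [gp p (by simp [*]) hp₀ hp₁, gp' p (by simp [*]) hp₁ hp₀]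
    · by_cases hr : r ∈ R
      · rw [gR r hr, gR' r hr]
      · rw [gr r hr, gr' r hr]
  subst hGG
  obtain ⟨L, hL⟩ := hC
  have hGreach : A.Reachable G' := Reachable.exec ⟨L, hL⟩ hG
  -- `q₀` will do the comparison; `exists_call` does not record that it ends idle. The suffix from
  -- here on is common to both orders.
  obtain ⟨Z, H, hZ, -, hH⟩ := hsolo.exists_idle hGreach {q₀}
  obtain ⟨s, hs⟩ := hH q₀ (by simp)
  have e₀ := ((hL.append hG).append hZ)
  have e₁ := ((hL.append hG').append hZ)
  obtain ⟨t₀, rfl⟩ : ∃ t, res₀ = .timestamp t := by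
    have := hA.admits (K := L ++ L₀) (K' := []) (p := q₀) (op := .getTS) (M := M₀)
      (res := res₀) (by simpa using (hL.append hL₀).append hα₀) hM₀
    cases res₀ with
    | timestamp t => exact ⟨t, rfl⟩
    | verdict => exact this.elim
  obtain ⟨t₁, rfl⟩ : ∃ t, res₁ = .timestamp t := by
    have := hA.admits (K := L ++ L₁) (K' := []) (p := q₁) (op := .getTS) (M := M₁)
      (res := res₁) (by simpa using (hL.append hL₁).append hα₁) hM₁
    cases res₁ with
    | timestamp t => exact ⟨t, rfl⟩
    | verdict => exact this.elim
  obtain ⟨M₂, res, J, hJ, -, hM₂⟩ :=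
    hsolo.exists_call (hGreach.exec hZ) hs (.compare t₀ t₁)
  obtain ⟨b, rfl⟩ : ∃ b, res = .verdict b := by
    have := hA.admits (K' := []) (by simpa only [List.append_nil] using e₀.append hJ) hM₂
    cases res with
    | timestamp t => exact this.elim
    | verdict b => exact ⟨b, rfl⟩
  have f₀ := hA.verdict (K₀ := L ++ L₀) (K₁ := X) (K₂ := Y ++ Z)
    (by simpa only [List.append_assoc] using e₀.append hJ) hM₀ hM₁ hM₂
  have f₁ := hA.verdict (K₀ := L ++ L₁) (K₁ := X') (K₂ := Y' ++ Z)
    (by simpa only [List.append_assoc] using e₁.append hJ) hM₁ hM₀ hM₂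
  have b₀ := f₀.1 ⟨rfl, rfl⟩
  have b₁ := f₁.2 ⟨rfl, rfl⟩
  simp [b₀] at b₁

/-! ### Signatures and stability. -/

/-- The number of processes in `P` that `t` assigns to the register `r`. -/
def sigOn (P : Finset (Fin n)) (t : Fin n → Option (Fin m)) (r : Fin m) : ℕ :=
  (P.filter fun p => t p = some r).card

/-- In `C`, every process in `P` covers the register that `t` assigns to it or, if there is none,
is idle. -/
def CoveredBy (A : Implementation n m T V Q) (C : Config n m T V Q) (P : Finset (Fin n))
    (t : Fin n → Option (Fin m)) : Prop :=
  ∀ p ∈ P, (∀ r, t p = some r → A.Covers C p r) ∧ (t p = none → ∃ q, C.proc p = .idle q)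

/-- The signatures with sum `k` and entries at most `3` that the processes in `P` can reach by
themselves from `D`, where those of them that do not cover registers are idle. -/
def signatures (A : Implementation n m T V Q) (P : Finset (Fin n)) (k : ℕ)
    (D : Config n m T V Q) : Set (Fin m → ℕ) :=
  {s | ∃ L C t, A.Exec D L C ∧ L.OnlyBy P ∧ A.CoveredBy C P t ∧ (∀ r, sigOn P t r = s r) ∧
    ∑ r, s r = k ∧ ∀ r, s r ≤ 3}

theorem finite_signatures (P : Finset (Fin n)) (k : ℕ) (D : Config n m T V Q) :
    (A.signatures P k D).Finite := by
  refine (Set.finite_Icc (0 : Fin m → ℕ) (fun _ => 3)).subset ?_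
  rintro s ⟨_, _, _, _, _, _, _, _, h⟩
  exact ⟨fun r => Nat.zero_le _, h⟩

/-- Steps by `P` can be prepended, so the set of reachable signatures only shrinks as `P` moves. -/
theorem Exec.signatures_subset {P : Finset (Fin n)} {D D' : Config n m T V Q}
    {L : Trace n m T V} (h : A.Exec D L D') (hL : L.OnlyBy P) (k : ℕ) :
    A.signatures P k D' ⊆ A.signatures P k D := by
  rintro s ⟨L', C, t, h', hL', hs⟩
  exact ⟨L ++ L', C, t, h.append h', hL.append hL', hs⟩

/-- The processes in `P` can reach a configuration from which on they cannot lose any reachable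
signature. -/
theorem exists_stable (A : Implementation n m T V Q) (P : Finset (Fin n)) (k : ℕ)
    (D : Config n m T V Q) :
    ∃ L D', A.Exec D L D' ∧ L.OnlyBy P ∧ ∀ L' D'', A.Exec D' L' D'' → L'.OnlyBy P →
      A.signatures P k D'' = A.signatures P k D' := by
  classical
  -- Minimize the number of reachable signatures. The bound 3 on the entries makes the set finite,
  -- so that no further loss means equality.
  have hex : ∃ c, ∃ L D', A.Exec D L D' ∧ L.OnlyBy P ∧ (A.signatures P k D').ncard = c :=
    ⟨_, [], D, .nil _, by simp [Trace.OnlyBy], rfl⟩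
  obtain ⟨L, D', h, hL, hc⟩ := Nat.find_spec hex
  refine ⟨L, D', h, hL, fun L' D'' h' hL' => ?_⟩
  refine Set.eq_of_subset_of_ncard_le (h'.signatures_subset hL' k) ?_ (finite_signatures _ _ _)
  rw [hc]
  exact Nat.find_min' hex ⟨_, _, h.append h', hL.append hL', rfl⟩

/-! ### Hiding a process that leaves the saturated registers. -/

theorem Covers.congr {C D : Config n m T V Q} {p : Fin n} {r : Fin m} (h : A.Covers C p r)
    (hp : D.proc p = C.proc p) : A.Covers D p r := by
  obtain ⟨op, q, v, next, h₁, h₂⟩ := h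
  exact ⟨op, q, v, next, hp.trans h₁, h₂⟩

/-- The escape of a process `q` after a block write is hidden from the other processes by a second
block write. -/
theorem Escapes.exists_hidden {C D₀ : Config n m T V Q} {P B₀ B₁ : Set (Fin n)} {R : Set (Fin m)}
    {w₁ : Fin m → V} {π₁ : Fin n → ProcState T Q} {q : Fin n} {L₀ : Trace n m T V}
    (h₀₁ : Disjoint B₀ B₁) (hB₀P : B₀ ⊆ P) (hB₁P : B₁ ⊆ P) (hq : q ∉ P)
    (hB₁ : A.BlockWrite C B₁ R w₁ π₁) (hL₀ : A.Exec C L₀ D₀) (hL₀B : L₀.OnlyBy B₀)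
    (hesc : A.Escapes D₀ q R) :
    ∃ L C' M E r, A.Exec C L C' ∧ L.OnlyBy P ∧ A.Exec C M E ∧ M.OnlyBy (insert q P) ∧
      E.reg = C'.reg ∧ (∀ p ∈ P, E.proc p = C'.proc p) ∧ r ∉ R ∧ A.Covers E q r := by
  obtain ⟨α, F, r, hα, hαq, hαR, hr, hcov⟩ := hesc
  have hD₀p : ∀ p ∈ B₁, D₀.proc p = C.proc p := fun p hp =>
    hL₀.proc_eq hL₀B fun h => Set.disjoint_left.1 h₀₁ h hp
  have hF : ∀ p ∈ P, F.proc p = D₀.proc p := fun p hp =>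
    hα.proc_eq hαq (by rintro rfl; exact hq hp)
  obtain ⟨X, C', hX, hXB, c₁, c₂, c₃⟩ := hB₁ D₀ hD₀p
  obtain ⟨Y, E, hY, hYB, e₁, e₂, e₃⟩ := hB₁ F fun p hp => by rw [hF p (hB₁P hp), hD₀p p hp]
  refine ⟨L₀ ++ X, C', L₀ ++ α ++ Y, E, r, hL₀.append hX,
    (hL₀B.mono hB₀P).append (hXB.mono hB₁P), (hL₀.append hα).append hY, ?_, ?_, ?_, hr, ?_⟩
  · have hP : P ⊆ insert q P := Set.subset_insert q P
    exact ((hL₀B.mono (hB₀P.trans hP)).append (hαq.mono (by simp))).append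
      (hYB.mono (hB₁P.trans hP))
  · funext x
    by_cases hx : x ∈ R
    · rw [e₂ x hx, c₂ x hx]
    · rw [e₃ x hx, c₃ x hx, hα.reg_eq hαR hx]
  · intro p hp
    by_cases hpB : p ∈ B₁
    · rw [e₁ p hpB, c₁ p hpB]
    · rw [hY.proc_eq hYB hpB, hX.proc_eq hXB hpB, hF p hp]
  · exact hcov.congr (hY.proc_eq hYB fun h => hq (hB₁P h))

/-- In a configuration in which the processes in `P` produce the signature `s`, one of two further
idle processes can be made to cover a register `r` with `s r ≠ 3`, unnoticed by `P`. -/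
theorem exists_hidden_of_coveredBy (hA : A.IsTimestampObject) (hsolo : A.SoloTerminating)
    {C : Config n m T V Q} (hC : A.Reachable C) {P : Finset (Fin n)} {t : Fin n → Option (Fin m)}
    (ht : A.CoveredBy C P t) {q₀ q₁ : Fin n} (hq₀ : q₀ ∉ P) (hq₁ : q₁ ∉ P) (hq : q₀ ≠ q₁)
    (hi₀ : ∃ s, C.proc q₀ = .idle s) (hi₁ : ∃ s, C.proc q₁ = .idle s) :
    ∃ q, (q = q₀ ∨ q = q₁) ∧ ∃ L C' M E r, A.Exec C L C' ∧ L.OnlyBy P ∧ A.Exec C M E ∧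
      M.OnlyBy (insert q (P : Set (Fin n))) ∧
      E.reg = C'.reg ∧ (∀ p ∈ P, E.proc p = C'.proc p) ∧ sigOn P t r ≠ 3 ∧ A.Covers E q r := by
  classical
  let R : Finset (Fin m) := Finset.univ.filter fun r => sigOn P t r = 3
  have hmemR : ∀ r, r ∈ R ↔ sigOn P t r = 3 := fun r => by simp [R]
  -- Stated for all `r` so that `choose` yields total functions; the values off `R` are irrelevant.
  have hthree : ∀ r, ∃ x y z, r ∈ R → x ≠ y ∧ x ≠ z ∧ y ≠ z ∧
      P.filter (fun p => t p = some r) = {x, y, z} := by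
    intro r
    by_cases hr : r ∈ R
    · obtain ⟨x, y, z, h⟩ := Finset.card_eq_three.1 ((hmemR r).1 hr)
      exact ⟨x, y, z, fun _ => h⟩
    · exact ⟨q₀, q₀, q₀, fun h => (hr h).elim⟩
  choose b₀ b₁ b₂ hb using hthree
  have m₀ : ∀ r ∈ R, b₀ r ∈ P ∧ t (b₀ r) = some r := fun r hr => by
    rw [← Finset.mem_filter (p := fun p => t p = some r), (hb r hr).2.2.2]; simp
  have m₁ : ∀ r ∈ R, b₁ r ∈ P ∧ t (b₁ r) = some r := fun r hr => by
    rw [← Finset.mem_filter (p := fun p => t p = some r), (hb r hr).2.2.2]; simp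
  have m₂ : ∀ r ∈ R, b₂ r ∈ P ∧ t (b₂ r) = some r := fun r hr => by
    rw [← Finset.mem_filter (p := fun p => t p = some r), (hb r hr).2.2.2]; simp
  have block : ∀ b : Fin m → Fin n, (∀ r ∈ R, b r ∈ P ∧ t (b r) = some r) →
      (∃ w π, A.BlockWrite C (b '' R) R w π) ∧ b '' R ⊆ (P : Set (Fin n)) := by
    intro b hb
    refine ⟨A.exists_blockWrite C R b (fun r hr r' hr' h => ?_) fun r hr =>
      (ht _ (hb r hr).1).1 r (hb r hr).2, ?_⟩
    · have := (hb r hr).2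
      rw [h, (hb r' hr').2] at this
      exact (Option.some.inj this).symm
    · rintro _ ⟨r, hr, rfl⟩
      exact (hb r hr).1
  have disj : ∀ b b' : Fin m → Fin n, (∀ r ∈ R, b r ∈ P ∧ t (b r) = some r) →
      (∀ r ∈ R, b' r ∈ P ∧ t (b' r) = some r) → (∀ r ∈ R, b r ≠ b' r) →
      Disjoint (b '' (R : Set (Fin m))) (b' '' R) := by
    intro b b' h h' hne
    rw [Set.disjoint_left]
    rintro _ ⟨r, hr, rfl⟩ ⟨r', hr', he⟩
    have := (h r hr).2
    rw [← he, (h' r' hr').2] at this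
    obtain rfl := Option.some.inj this
    exact hne _ hr he.symm
  obtain ⟨⟨w₀, π₀, hB₀⟩, hP₀⟩ := block b₀ m₀
  obtain ⟨⟨w₁, π₁, hB₁⟩, hP₁⟩ := block b₁ m₁
  obtain ⟨⟨w₂, π₂, hB₂⟩, hP₂⟩ := block b₂ m₂
  have h₀₁ := disj b₀ b₁ m₀ m₁ fun r hr => (hb r hr).1
  have h₀₂ := disj b₀ b₂ m₀ m₂ fun r hr => (hb r hr).2.1
  have h₁₂ := disj b₁ b₂ m₁ m₂ fun r hr => (hb r hr).2.2.1
  have hPP := Set.union_subset (Set.union_subset hP₀ hP₁) hP₂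
  obtain ⟨L₀, D₀, hL₀, hL₀B, d₀, d₀', d₀''⟩ := hB₀ C fun _ _ => rfl
  obtain ⟨L₁, D₁, hL₁, hL₁B, d₁, d₁', d₁''⟩ := hB₁ C fun _ _ => rfl
  have hnot : ∀ r, r ∉ (R : Set (Fin m)) → sigOn P t r ≠ 3 := fun r hr h => hr ((hmemR r).2 h)
  rcases escapes_or_escapes hA hsolo hC h₀₁ h₀₂ h₁₂ (fun h => hq₀ (hPP h)) (fun h => hq₁ (hPP h))
    hq hi₀ hi₁ hB₀ hB₁ hB₂ hL₀ hL₀B d₀ d₀' d₀'' hL₁ hL₁B d₁ d₁' d₁'' with h | h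
  · obtain ⟨L, C', M, E, r, k₁, k₂, k₃, k₄, k₅, k₆, k₇, k₈⟩ :=
      h.exists_hidden h₀₁ hP₀ hP₁ hq₀ hB₁ hL₀ hL₀B
    exact ⟨q₀, .inl rfl, L, C', M, E, r, k₁, k₂, k₃, k₄, k₅, k₆, hnot r k₇, k₈⟩
  · obtain ⟨L, C', M, E, r, k₁, k₂, k₃, k₄, k₅, k₆, k₇, k₈⟩ :=
      h.exists_hidden h₀₁.symm hP₁ hP₀ hq₁ hB₀ hL₁ hL₁B
    exact ⟨q₁, .inr rfl, L, C', M, E, r, k₁, k₂, k₃, k₄, k₅, k₆, hnot r k₇, k₈⟩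

/-- Adding a process `q` that covers the register `r`, and an idle process `q'`. -/
theorem CoveredBy.insert_insert {C E : Config n m T V Q} {P : Finset (Fin n)}
    {t : Fin n → Option (Fin m)} (ht : A.CoveredBy C P t) {q q' : Fin n} (hq : q ∉ P)
    (hq' : q' ∉ P) (hne : q ≠ q') (hE : ∀ p ∈ P, E.proc p = C.proc p) {r : Fin m}
    (hr : A.Covers E q r) (hi : ∃ s, E.proc q' = .idle s) :
    ∃ t', A.CoveredBy E (insert q (insert q' P)) t' ∧
      ∀ x, sigOn (insert q (insert q' P)) t' x = sigOn P t x + if x = r then 1 else 0 := by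
  let t' := Function.update (Function.update t q' none) q (some r)
  have tq : t' q = some r := by simp [t']
  have tq' : t' q' = none := by simp [t', Function.update_of_ne hne.symm]
  have tp : ∀ p ∈ P, t' p = t p := fun p hp => by
    have h₁ : p ≠ q := by rintro rfl; exact hq hp
    have h₂ : p ≠ q' := by rintro rfl; exact hq' hp
    simp [t', Function.update_of_ne h₁, Function.update_of_ne h₂]
  refine ⟨t', fun p hp => ?_, fun x => ?_⟩
  · rcases Finset.mem_insert.1 hp with rfl | hp
    · rw [tq]
      exact ⟨fun x hx => Option.some.inj hx ▸ hr, fun h => by simp at h⟩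
    rcases Finset.mem_insert.1 hp with rfl | hp
    · rw [tq']
      exact ⟨fun x hx => by simp at hx, fun _ => hi⟩
    rw [tp p hp]
    refine ⟨fun x hx => ((ht p hp).1 x hx).congr (hE p hp), fun h => ?_⟩
    rw [hE p hp]
    exact (ht p hp).2 h
  · have hfil : P.filter (fun p => t' p = some x) = P.filter (fun p => t p = some x) :=
      Finset.filter_congr fun p hp => by rw [tp p hp]
    unfold sigOn
    rw [Finset.filter_insert, Finset.filter_insert, tq, tq', hfil]
    rcases eq_or_ne x r with rfl | hx
    · simp [hq]
    · simp [hx, hx.symm]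

/-! ### The induction and the bound. -/

/-- Each increment of `k` uses up two processes: one becomes the new coverer, the other stays idle.
Quantifying over `P` and `D` lets the hypothesis apply to the smaller set from the stable
configuration. -/
theorem signatures_nonempty (hA : A.IsTimestampObject) (hsolo : A.SoloTerminating) (k : ℕ) :
    ∀ P : Finset (Fin n), 2 * k ≤ P.card → ∀ D, A.Reachable D →
      (A.signatures P k D).Nonempty := by
  induction k with
  | zero =>
    intro P _ D hD
    obtain ⟨L, C, hL, hLP, hi⟩ := hsolo.exists_idle hD P
    exact ⟨fun _ => 0, L, C, fun _ => none, hL, hLP, fun p hp => ⟨by simp, fun _ => hi p hp⟩,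
      by simp [sigOn], by simp, by simp⟩
  | succ k ih =>
    intro P hP D hD
    obtain ⟨q₀, h₀, q₁, h₁, hne⟩ := Finset.one_lt_card.1 (show 1 < P.card by omega)
    let P₀ := (P.erase q₀).erase q₁
    have hP₀P : (P₀ : Set (Fin n)) ⊆ P := fun p hp =>
      Finset.mem_of_mem_erase (Finset.mem_of_mem_erase hp)
    have hq₀ : q₀ ∉ P₀ := by simp [P₀]
    have hq₁ : q₁ ∉ P₀ := by simp [P₀]
    have hcard : 2 * k ≤ P₀.card := by
      rw [Finset.card_erase_of_mem (by simp [h₁, hne.symm]), Finset.card_erase_of_mem h₀]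
      omega
    have hins : insert q₀ (insert q₁ P₀) = P := by
      rw [Finset.insert_erase (by simp [h₁, hne.symm]), Finset.insert_erase h₀]
    -- Idling comes first: later moves of `P₀` leave `q₀` and `q₁` idle.
    obtain ⟨L₁, D₁, hL₁, hL₁P, hidle⟩ := hsolo.exists_idle hD P
    obtain ⟨L₂, D₂, hL₂, hL₂P, hstable⟩ := A.exists_stable P₀ k D₁
    have hD₂ := (hD.exec hL₁).exec hL₂
    obtain ⟨s, hs⟩ := ih P₀ hcard D₂ hD₂
    obtain ⟨L₃, C, t, hL₃, hL₃P, hcov, hsig, hsum, hle⟩ := id hs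
    have hidleC : ∀ q ∈ P, q ∉ P₀ → ∃ s, C.proc q = .idle s := fun q hq hq' => by
      rw [hL₃.proc_eq hL₃P hq', hL₂.proc_eq hL₂P hq']
      exact hidle q hq
    obtain ⟨q, hqq, L₄, C', M, E, r, hL₄, hL₄P, hM, hMP, hreg, hproc, hr, hEr⟩ :=
      exists_hidden_of_coveredBy hA hsolo (hD₂.exec hL₃) hcov hq₀ hq₁ hne (hidleC _ h₀ hq₀)
        (hidleC _ h₁ hq₁)
    obtain ⟨q', hq, hq', hqP, hq'P, hqne, hins'⟩ : ∃ q', q ∈ P ∧ q' ∈ P ∧ q ∉ P₀ ∧ q' ∉ P₀ ∧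
        q ≠ q' ∧ insert q (insert q' P₀) = P := by
      rcases hqq with rfl | rfl
      · exact ⟨q₁, h₀, h₁, hq₀, hq₁, hne, hins⟩
      · exact ⟨q₀, h₁, h₀, hq₁, hq₀, hne.symm, by rw [Finset.insert_comm, hins]⟩
    -- Stability: `s`, reached in `C`, is reachable again from `C'`, possibly with other processes
    -- covering. The run is then replayed from `E`, which `P₀` cannot tell from `C'`.
    rw [← hstable _ C' (hL₃.append hL₄) (hL₃P.append hL₄P)] at hs
    obtain ⟨L₅, C'', t', hL₅, hL₅P, hcov', hsig', -, -⟩ := hs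
    obtain ⟨E', hE', hE'p, -⟩ := hL₅.replay hL₅P (D := E) hproc hreg
    have hidleE : ∃ s, E'.proc q' = .idle s := by
      rw [hE'.proc_eq hL₅P hq'P, hM.proc_eq hMP (by simp [hqne.symm, hq'P])]
      exact hidleC q' hq' hq'P
    obtain ⟨t'', hcov'', hsig''⟩ := hcov'.insert_insert hqP hq'P hqne hE'p
      (hEr.congr (hE'.proc_eq hL₅P hqP)) hidleE
    rw [hins'] at hcov'' hsig''
    refine ⟨fun x => s x + if x = r then 1 else 0, L₁ ++ L₂ ++ L₃ ++ M ++ L₅, E', t'',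
      (((hL₁.append hL₂).append hL₃).append hM).append hE',
      (((hL₁P.append (hL₂P.mono hP₀P)).append (hL₃P.mono hP₀P)).append (hMP.mono ?_)).append
        (hL₅P.mono hP₀P), hcov'', fun x => by rw [hsig'', hsig'], ?_, fun x => ?_⟩
    · exact Set.insert_subset hq hP₀P
    · simp [Finset.sum_add_distrib, hsum]
    · have := hle x
      dsimp only
      split_ifs with hx
      -- The entry at the new register is at most 3 and not 3, so it can grow by one.
      · subst hx
        rw [hsig] at hr
        omega
      · omega

theorem exists_isThreeConfig (hA : A.IsTimestampObject) (hsolo : A.SoloTerminating) :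
    ∃ C, A.Reachable C ∧ A.IsThreeConfig C (n / 2) := by
  obtain ⟨s, L, C, t, hL, -, hcov, hsig, hsum, hle⟩ :=
    signatures_nonempty hA hsolo (n / 2) Finset.univ
      (by rw [Finset.card_univ, Fintype.card_fin]; omega) A.init ⟨[], .nil _⟩
  have hd : ∀ p, ∃ e : Event m T V, (∃ C', A.Step C p e C') ∧ e.writeTarget = t p := by
    intro p
    obtain ⟨h₁, h₂⟩ := hcov p (Finset.mem_univ p)
    cases htp : t p with
    | none =>
      obtain ⟨q, hq⟩ := h₂ htp
      -- An idle process can only invoke, which is no write; hence exactly `n / 2` processes cover.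
      exact ⟨.invoke .getTS, ⟨_, .invoke .getTS hq⟩, rfl⟩
    | some r =>
      obtain ⟨op, q, v, next, hq, ha⟩ := h₁ r htp
      exact ⟨.write r v, ⟨_, .write hq ha⟩, rfl⟩
  choose d hd hdt using hd
  have hsd : ∀ r, sig d r = s r := fun r => by
    rw [← hsig r]
    simp only [sig, sigOn, hdt]
  exact ⟨C, ⟨L, hL⟩, d, hd, by simp only [hsd, hsum], fun r => by rw [hsd]; exact hle r⟩

theorem IsThreeConfig.le_three_mul {C : Config n m T V Q} {k : ℕ} (h : A.IsThreeConfig C k) :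
    k ≤ 3 * m := by
  obtain ⟨d, -, rfl, hle⟩ := h
  calc ∑ r, sig d r ≤ ∑ _r : Fin m, 3 := Finset.sum_le_sum fun r _ => hle r
    _ = 3 * m := by simp [mul_comm]

end Implementation

end TimestampObject

theorem theorem1 {n m : ℕ} {T V Q : Type*}
    (A : TimestampObject.Implementation n m T V Q)
    (hA : A.IsTimestampObject) (hsolo : A.SoloTerminating) :
    (n : ℝ) / 6 - 1 ≤ (m : ℝ) ∧
      ∃ C, A.Reachable C ∧ A.IsThreeConfig C (n / 2) := by
  obtain ⟨C, hC, h⟩ := TimestampObject.Implementation.exists_isThreeConfig hA hsolo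
  refine ⟨?_, C, hC, h⟩
  -- `n / 2 ≤ 3 * m` even gives `n ≤ 6 * m + 1`; the weaker form suffices.
  have h6 : n ≤ 6 * m + 6 := by
    have := h.le_three_mul
    omega
  have : (n : ℝ) ≤ 6 * m + 6 := by exact_mod_cast h6
  linarith
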